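/- Let $d\ge 1$, $\alpha_i\in(1,2)$ and $d_{i,\pm}\ge 0$ with $d_{i,+}+d_{i,-}>0$ for $1\le i\le d$. Put $$t:=\max_{1\le i\le d}\frac{|d_{i,+}-d_{i,-}|}{d_{i,+}+d_{i,-}}\left|\tan\left(\frac{\alpha_i}{2}\pi\right)\right| .$$ For reals $a_i<b_i$, a time step $\tau>0$ and integers $n_i\ge1$ let $h_i=(b_i-a_i)/(n_i+1)$, $\mathbf n=(n_1,\dots,n_d)$, $n=n_1\cdots n_d$, and let $$\widetilde A_n=\frac1\tau I_n+\sum_{i=1}^d\left(\frac{d_{i,+}}{h_i^{\alpha_i}}\widetilde W_i+\frac{d_{i,-}}{h_i^{\alpha_i}}\widetilde W_i^{\top}\right),\qquad \widetilde W_i=I_{n_1\cdots n_{i-1}}\otimes\widetilde L_{n_i}^{(\alpha_i)}\otimes I_{n_{i+1}\cdots n_d},$$ be the matrix of the first-order scheme (backward Euler in time, shifted Grünwald in space) for the Riemann-Liouville fractional diffusion equation on $\prod_i(a_i,b_i)$. Here $\widetilde L_m^{(\alpha)}\in\mathbb R^{m\times m}$ has the entry $-\widetilde g^{(\alpha)}_{j-l+1}$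 at $(j,l)$ if $j-l+1\ge0$, and $0$ otherwise, with $\widetilde g^{(\alpha)}_k=(-1)^k\binom{\alpha}{k}$. Let $Y_n=Y_{n_1}\otimes\cdots\otimes Y_{n_d}$, where $Y_m$ is the $m\times m$ anti-identity matrix, and let $\mathcal H=\mathcal H(\widetilde A_n)=(\widetilde A_n+\widetilde A_n^\top)/2$. There is a number $\varepsilon$ depending only on $d$, $(\alpha_i)$, $(d_{i,\pm})$, with $0<\varepsilon<t$ if $t>0$ and $\varepsilon=0$ if $t=0$, such that for $\omega:=\sqrt{\varepsilon/(2+\varepsilon)}$ (so that $\omega\in(0,1)$ if $t>0$) and for all $a_i<b_i$, $\tau>0$ and $\mathbf n$ the following hold. 1. $\mathcal H$ is symmetric positive definite and $Y_n\widetilde A_n$ is symmetric. 2. All (complex) eigenvalues of $\mathcal H^{-1}Y_n\widetilde A_n$ are real and lie in $[-(1+\varepsilon),-1]\cup[1,1+\varepsilon]$. 3. MINRES with preconditioner $\mathcal H$ for $Y_n\widetilde A_n\mathbf x=Y_n\mathbf b$ has a convergence rate independent of $\mathbf n$. That is, for every right-hand side $\mathbf b\in\mathbb R^n$, every initial guess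 $\mathbf u^{(0)}$ and every $k\ge0$, the preconditioned residual $\mathbf r^{(k)}=\mathcal H^{-1}Y_n\mathbf b-\mathcal H^{-1}Y_n\widetilde A_n\mathbf u^{(k)}$ satisfies $$\|\mathbf r^{(k)}\|_{\mathcal H}\le 2\,\omega^{2\lfloor k/2\rfloor}\,\|\mathbf r^{(0)}\|_{\mathcal H},\qquad \|\mathbf r\|_{\mathcal H}:=\sqrt{\mathbf r^\top\mathcal H\mathbf r}=\|\mathcal H^{1/2}\mathbf r\|_2 .$$ Here the $k$-th MINRES iterate $\mathbf u^{(k)}$ is the vector of $\mathbf u^{(0)}+\mathrm{span}\{(\mathcal H^{-1}Y_n\widetilde A_n)^j\mathbf r^{(0)}:0\le j<k\}$ whose preconditioned residual has the smallest norm $\|\cdot\|_{\mathcal H}$; this norm equals $\|\mathcal H^{-1/2}(Y_n\mathbf b-Y_n\widetilde A_n\mathbf u^{(k)})\|_2$. (For $\omega=0$, $\omega^0=1$.) -/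

import Mathlib

namespace FirstOrderScheme

noncomputable section

/-- Multi-indices of the grid with `n i` interior points in direction `i`. Real `n × n` matrices,
`n = n_1 ⋯ n_d`, and vectors of length `n` are indexed by multi-indices. -/
abbrev Grid {d : ℕ} (n : Fin d → ℕ) : Type := (i : Fin d) → Fin (n i)

/-- The Kronecker product `M_1 ⊗ ⋯ ⊗ M_d`, with rows and columns indexed by multi-indices. -/
def kroneckerProd {d : ℕ} {n : Fin d → ℕ} (M : (i : Fin d) → Matrix (Fin (n i)) (Fin (n i)) ℝ) :
    Matrix (Grid n) (Grid n) ℝ :=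
  Matrix.of fun j l => ∏ i, M i (j i) (l i)

/-- `I ⊗ B ⊗ I`, the matrix `B` acting in direction `i` and the identity in the others. -/
def inDirection {d : ℕ} {n : Fin d → ℕ} (i : Fin d) (B : Matrix (Fin (n i)) (Fin (n i)) ℝ) :
    Matrix (Grid n) (Grid n) ℝ :=
  kroneckerProd (Function.update (fun _ => 1) i B)

/-- The anti-identity matrix `Y_m`: ones exactly at the entries `(j, l)` with `j + l = m + 1`
for indices starting from `1`, i.e. `j + l + 1 = m` for indices starting from `0`. -/
def antiIdentity (m : ℕ) : Matrix (Fin m) (Fin m) ℝ :=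
  Matrix.of fun j l => if (j : ℕ) + (l : ℕ) + 1 = m then 1 else 0

/-- The multilevel anti-identity `Y_n = Y_{n_1} ⊗ ⋯ ⊗ Y_{n_d}`. -/
def multiAntiIdentity {d : ℕ} (n : Fin d → ℕ) : Matrix (Grid n) (Grid n) ℝ :=
  kroneckerProd fun i => antiIdentity (n i)

/-- The Grünwald coefficient `(-1)^k α (α - 1) ⋯ (α - k + 1) / k!`. -/
def grunwaldCoeff (α : ℝ) (k : ℕ) : ℝ :=
  (-1) ^ k / (k.factorial : ℝ) * ∏ m ∈ Finset.range k, (α - (m : ℝ))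

/-- The shifted Grünwald matrix: the entry `(j, l)` is minus the Grünwald coefficient of index
`j - l + 1` if this index is nonnegative, and `0` otherwise. -/
def grunwaldMatrix (α : ℝ) (m : ℕ) : Matrix (Fin m) (Fin m) ℝ :=
  Matrix.of fun j l =>
    if (l : ℕ) ≤ (j : ℕ) + 1 then - grunwaldCoeff α ((j : ℕ) + 1 - (l : ℕ)) else 0

/-- The step size `h_i = (b_i - a_i) / (n_i + 1)`. -/
def stepSize {d : ℕ} (a b : Fin d → ℝ) (n : Fin d → ℕ) (i : Fin d) : ℝ :=
  (b i - a i) / ((n i : ℝ) + 1)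

/-- The coefficient matrix of the first-order scheme (backward Euler in time with step `τ`, shifted
Grünwald in space) for the fractional diffusion equation with orders `α` and diffusion
coefficients `dp`, `dm` (left and right) on the box with corners `a`, `b`. -/
def schemeMatrix {d : ℕ} (α dp dm : Fin d → ℝ) (τ : ℝ) (a b : Fin d → ℝ) (n : Fin d → ℕ) :
    Matrix (Grid n) (Grid n) ℝ :=
  (1 / τ) • (1 : Matrix (Grid n) (Grid n) ℝ) +
    ∑ i, ((dp i / stepSize a b n i ^ α i) • inDirection i (grunwaldMatrix (α i) (n i)) +
      (dm i / stepSize a b n i ^ α i) •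
        (inDirection i (grunwaldMatrix (α i) (n i))).transpose)

/-- The symmetric part `(Z + Zᵀ) / 2`. -/
def symmPart {ι : Type*} (Z : Matrix ι ι ℝ) : Matrix ι ι ℝ :=
  (1 / 2 : ℝ) • (Z + Z.transpose)

/-- The norm `√(rᵀ P r)` defined by a symmetric positive definite matrix `P`. -/
def energyNorm {ι : Type*} [Fintype ι] (P : Matrix ι ι ℝ) (r : ι → ℝ) : ℝ :=
  Real.sqrt (dotProduct r (P.mulVec r))

/-- The residual `P⁻¹ c - P⁻¹ K u` of `u` in the preconditioned system `P⁻¹ K x = P⁻¹ c`. -/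
def precondResidual {ι : Type*} [Fintype ι] [DecidableEq ι] (P K : Matrix ι ι ℝ)
    (c u : ι → ℝ) : ι → ℝ :=
  P⁻¹.mulVec c - (P⁻¹ * K).mulVec u

/-- The Krylov space spanned by `z, M z, …, M^(k-1) z`. -/
def krylov {ι : Type*} [Fintype ι] [DecidableEq ι] (M : Matrix ι ι ℝ) (z : ι → ℝ) (k : ℕ) :
    Submodule ℝ (ι → ℝ) :=
  Submodule.span ℝ (Set.range fun j : Fin k => (M ^ (j : ℕ)).mulVec z)

/-- `u` is the `k`-th iterate of the MINRES method for `K x = c` (`K` symmetric) with symmetric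
positive definite preconditioner `P` and initial guess `u₀`: among all vectors of
`u₀ + span {z, (P⁻¹ K) z, …, (P⁻¹ K)^(k-1) z}`, where `z` is the initial preconditioned residual,
it minimizes the norm `√(rᵀ P r) = ‖P^(-1/2) (c - K u)‖₂` of the preconditioned residual `r`. -/
def IsMinresIterate {ι : Type*} [Fintype ι] [DecidableEq ι] (P K : Matrix ι ι ℝ)
    (c u₀ : ι → ℝ) (k : ℕ) (u : ι → ℝ) : Prop :=
  u - u₀ ∈ krylov (P⁻¹ * K) (precondResidual P K c u₀) k ∧
    ∀ v : ι → ℝ, v - u₀ ∈ krylov (P⁻¹ * K) (precondResidual P K c u₀) k →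
      energyNorm P (precondResidual P K c u) ≤ energyNorm P (precondResidual P K c v)

/-- `max_i |d_{i,+} - d_{i,-}| / (d_{i,+} + d_{i,-}) * |tan (α_i π / 2)|`, a maximum over a
nonempty finite set when `0 < d`. -/
def asymmetryBound {d : ℕ} (α dp dm : Fin d → ℝ) : ℝ :=
  ⨆ i, |dp i - dm i| / (dp i + dm i) * |Real.tan (α i / 2 * Real.pi)|

/-- The convergence rate `ω = √(ε / (2 + ε))`. -/
def rate (ε : ℝ) : ℝ := Real.sqrt (ε / (2 + ε))

end

end FirstOrderScheme

/-!
The Grünwald matrix is the Toeplitz matrix of the symbol `-e^{-iθ} (1 - e^{iθ})^α`. For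
`0 < θ < 2π` one has `1 - e^{iθ} = 2 sin (θ/2) e^{i(θ-π)/2}`, so the argument of the symbol is an
explicit affine function of `θ` and the symbol stays in the sector `|Im w| ≤ |tan (απ/2)| Re w`.
Integrating against `|∑ z_l e^{ilθ}|²`, the numerical range of the Grünwald matrix lies in the same
sector. Sectors are inherited by Kronecker products with identities and by sums, and mixing a
matrix with its transpose with weights `p`, `m` shrinks the opening by `|p - m| / (p + m)`; hence
the numerical range of `A` lies in the sector of opening `t`.

Toeplitz structure gives `Y A Y = Aᵀ`, so `Y` commutes with the symmetric part `H` of `A` and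
anticommutes with the skew part `S`. Therefore `(H⁻¹ Y A)² = 1 - (H⁻¹ S)²`, and the sector bound
says exactly that the eigenvalues of `-(H⁻¹ S)²` lie in `[0, t²]`. So every eigenvalue `μ` of
`H⁻¹ Y A` satisfies `1 ≤ μ² ≤ 1 + t² = (1 + ε)²` with `ε = √(1 + t²) - 1`. The MINRES residual is
compared with the Chebyshev polynomial of degree `⌊k/2⌋` for `[1, (1 + ε)²]`, evaluated at `μ²`.
-/

namespace FirstOrderScheme

section Fourier

open Complex Set
open scoped Real

theorem integral_exp_int_mul_I (n : ℤ) :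
    ∫ θ in (0 : ℝ)..2 * π, exp (n * θ * I) = if n = 0 then 2 * (π : ℂ) else 0 := by
  split_ifs with hn
  · simp [hn]
  · have hnI : (n : ℂ) * I ≠ 0 := by simp [hn]
    have hperiod : exp (n * I * ↑(2 * π)) = 1 :=
      exp_eq_one_iff.mpr ⟨n, by push_cast; ring⟩
    simp_rw [mul_right_comm _ _ I]
    rw [integral_exp_mul_complex hnI, hperiod]
    simp

theorem integral_mul_exp_int_of_hasSum {a : ℕ → ℂ} {f : ℂ → ℂ} {r : ℝ} (hr : 0 ≤ r)
    (hf : ∀ z, ‖z‖ = r → HasSum (fun k => a k * z ^ k) (f z)) (n : ℤ) :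
    ∫ θ in (0 : ℝ)..2 * π, f (r * exp (θ * I)) * exp (n * θ * I) =
      2 * π * if n ≤ 0 then a n.natAbs * r ^ n.natAbs else 0 := by
  have norm_circle (θ : ℝ) : ‖(r : ℂ) * exp (θ * I)‖ = r := by
    rw [norm_mul, norm_exp_ofReal_mul_I, mul_one, norm_real, Real.norm_of_nonneg hr]
  have summable_norm : Summable fun k => ‖a k‖ * r ^ k := by
    simpa [abs_of_nonneg hr] using (hf r (by simpa using hr)).summable.norm
  have termwise : HasSum
      (fun k => ∫ θ in (0 : ℝ)..2 * π, a k * (r * exp (θ * I)) ^ k * exp (n * θ * I))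
      (∫ θ in (0 : ℝ)..2 * π, f (r * exp (θ * I)) * exp (n * θ * I)) := by
    refine intervalIntegral.hasSum_integral_of_dominated_convergence
      (fun k _ => ‖a k‖ * r ^ k) (fun k => Continuous.aestronglyMeasurable (by fun_prop))
      (fun k => .of_forall fun θ _ => ?_) (.of_forall fun _ _ => summable_norm) (by simp)
      (.of_forall fun θ _ => (hf _ (norm_circle θ)).mul_right _)
    rw [norm_mul, norm_mul, norm_pow, norm_circle]
    simp [norm_exp]
  have integral_term (k : ℕ) :
      ∫ θ in (0 : ℝ)..2 * π, a k * (r * exp (θ * I)) ^ k * exp (n * θ * I) =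
        a k * r ^ k * if (k : ℤ) + n = 0 then 2 * (π : ℂ) else 0 := by
    rw [← integral_exp_int_mul_I, ← intervalIntegral.integral_const_mul]
    congr 1 with θ
    rw [mul_pow, ← exp_nat_mul, ← mul_assoc, mul_assoc, ← exp_add]
    push_cast
    ring_nf
  simp only [integral_term] at termwise
  refine termwise.unique ?_
  split_ifs with hn
  · convert hasSum_single n.natAbs fun k hk => ?_ using 1
    · rw [if_pos (by omega), mul_comm]
    · rw [if_neg (by omega), mul_zero]
  · convert hasSum_zero using 2 with k
    · rw [if_neg (by omega), mul_zero]
    · rw [mul_zero]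

theorem integral_mul_exp_int_of_continuousOn_closedBall {a : ℕ → ℂ} {f : ℂ → ℂ}
    (hfc : ContinuousOn f (Metric.closedBall 0 1))
    (hf : ∀ z, ‖z‖ < 1 → HasSum (fun k => a k * z ^ k) (f z)) (n : ℤ) :
    ∫ θ in (0 : ℝ)..2 * π, f (exp (θ * I)) * exp (n * θ * I) =
      2 * π * if n ≤ 0 then a n.natAbs else 0 := by
  let F (r : ℝ) : ℂ :=
    ∫ θ in (0 : ℝ)..2 * π, f ((projIcc 0 1 zero_le_one r : ℝ) * exp (θ * I)) * exp (n * θ * I)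
  let G (r : ℝ) : ℂ := 2 * π * if n ≤ 0 then a n.natAbs * r ^ n.natAbs else 0
  have continuous_F : Continuous F := by
    refine intervalIntegral.continuous_parametric_intervalIntegral_of_continuous' ?_ _ _
    refine (hfc.comp_continuous ?_ fun p => ?_).mul (by fun_prop)
    · have : Continuous (projIcc (0 : ℝ) 1 zero_le_one) := continuous_projIcc
      fun_prop
    · have hmem := (projIcc (0 : ℝ) 1 zero_le_one p.1).2
      rw [mem_closedBall_zero_iff, norm_mul, norm_exp_ofReal_mul_I, mul_one, norm_real,
        Real.norm_of_nonneg hmem.1]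
      exact hmem.2
  have continuous_G : Continuous G := by
    unfold G
    split_ifs <;> fun_prop
  have eqOn : EqOn F G (Ico 0 1) := fun r hr => by
    simp only [F, G, projIcc_of_mem zero_le_one (Ico_subset_Icc_self hr)]
    exact integral_mul_exp_int_of_hasSum hr.1 (fun z hz => hf z (hz ▸ hr.2)) n
  have hFG := eqOn.closure continuous_F continuous_G
    (show (1 : ℝ) ∈ closure (Ico 0 1) by simp [closure_Ico])
  simpa [F, G] using hFG

end Fourier

section Binomial

open Complex
open scoped Real

theorem grunwaldCoeff_eq_choose (α : ℝ) (k : ℕ) :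
    grunwaldCoeff α k = (-1) ^ k * Ring.choose α k := by
  have hprod : ∏ m ∈ Finset.range k, (α - m) = (descPochhammer ℤ k).smeval α := by
    rw [← descPochhammer_eval_eq_prod_range, ← Polynomial.aeval_eq_smeval,
      ← Polynomial.eval_map_algebraMap, descPochhammer_map]
  rw [grunwaldCoeff, Ring.choose_eq_smul, hprod, smul_eq_mul]
  ring

theorem hasSum_grunwaldCoeff_mul_pow (α : ℝ) {z : ℂ} (hz : ‖z‖ < 1) :
    HasSum (fun k => (grunwaldCoeff α k : ℂ) * z ^ k) ((1 - z) ^ (α : ℂ)) := by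
  have h := (one_add_cpow_hasFPowerSeriesOnBall_zero (a := (α : ℂ))).hasSum
    (y := -z) (by simpa [← ofReal_norm] using hz)
  simp only [binomialSeries_apply, List.ofFn_const, List.prod_replicate, smul_eq_mul,
    zero_sub, ← sub_eq_add_neg] at h
  refine h.congr_fun fun k => ?_
  rw [grunwaldCoeff_eq_choose, neg_pow z]
  push_cast [ofReal_choose]
  ring

theorem continuousOn_one_sub_cpow {a : ℂ} (ha : 0 < a.re) :
    ContinuousOn (fun z : ℂ => (1 - z) ^ a) (Metric.closedBall 0 1) := fun z hz => by
  have hre : 0 ≤ (1 - z).re := by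
    simpa using (re_le_norm z).trans (mem_closedBall_zero_iff.mp hz)
  exact ((continuousAt_cpow_const_of_re_pos (.inl hre) ha).comp
    (f := fun z : ℂ => 1 - z) (by fun_prop)).continuousWithinAt

end Binomial

section Symbol

open Complex
open scoped Real

/-- The symbol `-e^{-iθ} (1 - e^{iθ})^α` whose Fourier coefficients are the entries of the shifted
Grünwald matrices. -/
noncomputable def grunwaldSymbol (α θ : ℝ) : ℂ :=
  -((1 - exp (θ * I)) ^ (α : ℂ) * exp (-θ * I))

theorem continuous_grunwaldSymbol {α : ℝ} (hα : 0 < α) : Continuous (grunwaldSymbol α) := by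
  have hcpow : Continuous fun θ : ℝ => (1 - exp (θ * I)) ^ (α : ℂ) :=
    (continuousOn_one_sub_cpow (by simpa using hα)).comp_continuous (by fun_prop) fun θ => by
      rw [mem_closedBall_zero_iff, norm_exp_ofReal_mul_I]
  exact (hcpow.mul (by fun_prop)).neg

theorem integral_grunwaldSymbol_mul_exp {α : ℝ} (hα : 0 < α) (n : ℤ) :
    ∫ θ in (0 : ℝ)..2 * π, grunwaldSymbol α θ * exp (n * θ * I) =
      2 * π * if n ≤ 1 then -(grunwaldCoeff α (1 - n).toNat : ℂ) else 0 := by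
  have hshift (θ : ℝ) : grunwaldSymbol α θ * exp (n * θ * I) =
      -((1 - exp (θ * I)) ^ (α : ℂ) * exp ((n - 1 : ℤ) * θ * I)) := by
    rw [grunwaldSymbol, neg_mul, mul_assoc, ← exp_add]
    push_cast
    ring_nf
  simp only [hshift, intervalIntegral.integral_neg]
  rw [integral_mul_exp_int_of_continuousOn_closedBall (f := fun z => (1 - z) ^ (α : ℂ))
    (continuousOn_one_sub_cpow (by simpa using hα))
    (fun z hz => hasSum_grunwaldCoeff_mul_pow α hz), ← mul_neg]
  split_ifs
  · rw [show (n - 1).natAbs = (1 - n).toNat by omega]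
  · omega
  · omega
  · rw [neg_zero]

theorem one_sub_exp_mul_I (z : ℂ) :
    1 - exp (z * I) = 2 * sin (z / 2) * exp ((z - π) / 2 * I) := by
  have hsq : exp (z * I) = exp (z / 2 * I) * exp (z / 2 * I) := by
    rw [← exp_add]
    ring_nf
  have hinv : exp (-(z / 2) * I) * exp (z / 2 * I) = 1 := by
    rw [← exp_add, neg_mul, neg_add_cancel, exp_zero]
  rw [sub_div, sub_mul, exp_sub, exp_pi_div_two_mul_I, div_I, hsq, two_sin]
  linear_combination
    -hinv + (exp (-(z / 2) * I) - exp (z / 2 * I)) * exp (z / 2 * I) * I_mul_I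

theorem ofReal_mul_exp_mul_I_cpow {r φ : ℝ} (hr : 0 < r) (hφ : φ ∈ Set.Ioc (-π) π) (a : ℝ) :
    (r * exp (φ * I)) ^ (a : ℂ) = (r ^ a : ℝ) * exp ((φ * a : ℝ) * I) := by
  have hr' : (r : ℂ) ≠ 0 := ofReal_ne_zero.mpr hr.ne'
  have hlog : log (exp (φ * I)) = φ * I := log_exp (by simpa using hφ.1) (by simpa using hφ.2)
  rw [cpow_def_of_ne_zero (mul_ne_zero hr' (exp_ne_zero _)), log_ofReal_mul hr (exp_ne_zero _),
    hlog, add_mul, exp_add, ofReal_cpow hr.le, cpow_def_of_ne_zero hr', ofReal_log hr.le]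
  push_cast
  ring_nf

theorem grunwaldSymbol_eq (α : ℝ) {θ : ℝ} (hθ : θ ∈ Set.Ioo 0 (2 * π)) :
    grunwaldSymbol α θ =
      ((2 * Real.sin (θ / 2)) ^ α : ℝ) * exp (((π - θ) * (1 - α / 2) : ℝ) * I) := by
  have hsin : 0 < 2 * Real.sin (θ / 2) :=
    mul_pos two_pos (Real.sin_pos_of_pos_of_lt_pi (by linarith [hθ.1]) (by linarith [hθ.2]))
  have hpolar : 1 - exp (θ * I) =
      (2 * Real.sin (θ / 2) : ℝ) * exp (((θ - π) / 2 : ℝ) * I) := by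
    exact_mod_cast one_sub_exp_mul_I θ
  rw [grunwaldSymbol, hpolar,
    ofReal_mul_exp_mul_I_cpow hsin
      ⟨by linarith [hθ.1, Real.pi_pos], by linarith [hθ.2, Real.pi_pos]⟩,
    mul_assoc, ← exp_add, ← mul_neg, ← neg_one_mul (exp _), ← exp_pi_mul_I, ← exp_add]
  push_cast
  ring_nf

theorem abs_sin_le_abs_tan_mul_cos {φ β : ℝ} (hφ : |φ| ≤ |β|) (hβ : |β| < π / 2) :
    |Real.sin φ| ≤ |Real.tan β| * Real.cos φ := by
  have hcos : 0 < Real.cos β := Real.cos_pos_of_mem_Ioo (abs_lt.mp hβ)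
  have hsin : |Real.sin φ| * Real.cos β ≤ |Real.sin β| * Real.cos φ := by
    have h : 0 ≤ Real.sin (|β| - |φ|) :=
      Real.sin_nonneg_of_nonneg_of_le_pi (sub_nonneg.mpr hφ)
        (by linarith [abs_nonneg φ, Real.pi_pos])
    rw [Real.sin_sub, Real.cos_abs, Real.cos_abs,
      ← Real.abs_sin_eq_sin_abs_of_abs_le_pi (by linarith [Real.pi_pos]),
      ← Real.abs_sin_eq_sin_abs_of_abs_le_pi (by linarith [Real.pi_pos])] at h
    linarith
  rwa [Real.tan_eq_sin_div_cos, abs_div, abs_of_pos hcos, div_mul_eq_mul_div, le_div_iff₀ hcos]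

theorem abs_tan_pi_mul_one_sub (x : ℝ) : |Real.tan (π * (1 - x))| = |Real.tan (x * π)| := by
  rw [mul_one_sub, Real.tan_pi_sub, abs_neg, mul_comm]

theorem grunwaldSymbol_re_nonneg_and_abs_im_le {α θ : ℝ} (hα : 1 < α ∧ α < 3)
    (hθ : θ ∈ Set.Ioo 0 (2 * π)) :
    0 ≤ (grunwaldSymbol α θ).re ∧
      |(grunwaldSymbol α θ).im| ≤ |Real.tan (α / 2 * π)| * (grunwaldSymbol α θ).re := by
  have hα' : |1 - α / 2| < 1 / 2 := abs_lt.mpr ⟨by linarith, by linarith⟩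
  have hβ : |π * (1 - α / 2)| < π / 2 := by
    rw [abs_mul, abs_of_pos Real.pi_pos]
    linarith [mul_lt_mul_of_pos_left hα' Real.pi_pos]
  have hφ : |(π - θ) * (1 - α / 2)| ≤ |π * (1 - α / 2)| := by
    rw [abs_mul, abs_mul, abs_of_pos Real.pi_pos]
    exact mul_le_mul_of_nonneg_right (abs_le.mpr ⟨by linarith [hθ.2], by linarith [hθ.1]⟩)
      (abs_nonneg _)
  have hr : 0 ≤ (2 * Real.sin (θ / 2)) ^ α :=
    Real.rpow_nonneg (mul_nonneg two_pos.le
      (Real.sin_nonneg_of_nonneg_of_le_pi (by linarith [hθ.1]) (by linarith [hθ.2]))) _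
  rw [grunwaldSymbol_eq α hθ, re_ofReal_mul, im_ofReal_mul, exp_ofReal_mul_I_re,
    exp_ofReal_mul_I_im, abs_mul, abs_of_nonneg hr, mul_left_comm, ← abs_tan_pi_mul_one_sub]
  exact ⟨mul_nonneg hr (Real.cos_nonneg_of_mem_Icc (abs_le.mp (hφ.trans hβ.le))),
    mul_le_mul_of_nonneg_left (abs_sin_le_abs_tan_mul_cos hφ hβ) hr⟩

end Symbol

section SectorialForm

open Matrix

variable {ι κ : Type*} [Fintype ι] [Fintype κ] {B C : Matrix ι ι ℝ} {S T c : ℝ}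

/-- The numerical range of `B` on complex vectors lies in the sector `|Im w| ≤ T * Re w`, written
out for the real and imaginary parts of `(x + iy)ᴴ B (x + iy)`. -/
structure HasSectorialForm (T : ℝ) (B : Matrix ι ι ℝ) : Prop where
  nonneg (x : ι → ℝ) : 0 ≤ x ⬝ᵥ B *ᵥ x
  abs_sub_le (x y : ι → ℝ) :
    |x ⬝ᵥ B *ᵥ y - y ⬝ᵥ B *ᵥ x| ≤ T * (x ⬝ᵥ B *ᵥ x + y ⬝ᵥ B *ᵥ y)

namespace HasSectorialForm

theorem zero : HasSectorialForm T (0 : Matrix ι ι ℝ) where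
  nonneg x := by simp
  abs_sub_le x y := by simp

theorem one [DecidableEq ι] (hT : 0 ≤ T) : HasSectorialForm T (1 : Matrix ι ι ℝ) where
  nonneg x := by simpa using dotProduct_star_self_nonneg x
  abs_sub_le x y := by
    rw [one_mulVec, one_mulVec, dotProduct_comm y x, sub_self, abs_zero]
    exact mul_nonneg hT (add_nonneg (dotProduct_star_self_nonneg x) (dotProduct_star_self_nonneg y))

theorem add (hB : HasSectorialForm T B) (hC : HasSectorialForm T C) :
    HasSectorialForm T (B + C) where
  nonneg x := by
    rw [add_mulVec, dotProduct_add]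
    exact add_nonneg (hB.nonneg x) (hC.nonneg x)
  abs_sub_le x y := by
    simp only [add_mulVec, dotProduct_add, add_sub_add_comm]
    linarith [abs_add_le (x ⬝ᵥ B *ᵥ y - y ⬝ᵥ B *ᵥ x) (x ⬝ᵥ C *ᵥ y - y ⬝ᵥ C *ᵥ x),
      hB.abs_sub_le x y, hC.abs_sub_le x y]

theorem sum {σ : Type*} {s : Finset σ} {B : σ → Matrix ι ι ℝ}
    (hB : ∀ i ∈ s, HasSectorialForm T (B i)) : HasSectorialForm T (∑ i ∈ s, B i) :=
  Finset.sum_induction _ _ (fun _ _ => add) zero hB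

theorem smul (hc : 0 ≤ c) (hB : HasSectorialForm T B) : HasSectorialForm T (c • B) where
  nonneg x := by
    rw [smul_mulVec, dotProduct_smul]
    exact mul_nonneg hc (hB.nonneg x)
  abs_sub_le x y := by
    simp only [smul_mulVec, dotProduct_smul, smul_eq_mul, ← mul_sub, ← mul_add]
    rw [abs_mul, abs_of_nonneg hc, mul_left_comm]
    exact mul_le_mul_of_nonneg_left (hB.abs_sub_le x y) hc

theorem smul_add_smul_transpose {p m : ℝ} (hB : HasSectorialForm S B) (hpm : 0 ≤ p + m)
    (hT : |p - m| * S ≤ T * (p + m)) : HasSectorialForm T (p • B + m • Bᵀ) := by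
  have form_eq (x y : ι → ℝ) :
      x ⬝ᵥ (p • B + m • Bᵀ) *ᵥ y = p * (x ⬝ᵥ B *ᵥ y) + m * (y ⬝ᵥ B *ᵥ x) := by
    rw [add_mulVec, dotProduct_add, smul_mulVec, smul_mulVec, dotProduct_smul, dotProduct_smul,
      dotProduct_transpose_mulVec, smul_eq_mul, smul_eq_mul]
  refine ⟨fun x => ?_, fun x y => ?_⟩
  · rw [form_eq, ← add_mul]
    exact mul_nonneg hpm (hB.nonneg x)
  · have hsum := add_nonneg (hB.nonneg x) (hB.nonneg y)
    simp only [form_eq]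
    calc |p * (x ⬝ᵥ B *ᵥ y) + m * (y ⬝ᵥ B *ᵥ x) - (p * (y ⬝ᵥ B *ᵥ x) + m * (x ⬝ᵥ B *ᵥ y))|
        = |p - m| * |x ⬝ᵥ B *ᵥ y - y ⬝ᵥ B *ᵥ x| := by rw [← abs_mul]; ring_nf
      _ ≤ |p - m| * (S * (x ⬝ᵥ B *ᵥ x + y ⬝ᵥ B *ᵥ y)) := by gcongr; exact hB.abs_sub_le x y
      _ ≤ T * (p + m) * (x ⬝ᵥ B *ᵥ x + y ⬝ᵥ B *ᵥ y) := by rw [← mul_assoc]; gcongr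
      _ = _ := by ring

theorem submatrix (hB : HasSectorialForm T B) (e : κ ≃ ι) :
    HasSectorialForm T (B.submatrix e e) := by
  have form_eq (x y : κ → ℝ) :
      x ⬝ᵥ B.submatrix e e *ᵥ y = (x ∘ e.symm) ⬝ᵥ B *ᵥ (y ∘ e.symm) := by
    rw [submatrix_mulVec_equiv, ← comp_equiv_symm_dotProduct]
  exact ⟨fun x => by simpa only [form_eq] using hB.nonneg _,
    fun x y => by simpa only [form_eq] using hB.abs_sub_le _ _⟩

theorem blockDiagonal [DecidableEq κ] {B : κ → Matrix ι ι ℝ}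
    (hB : ∀ k, HasSectorialForm T (B k)) : HasSectorialForm T (blockDiagonal B) := by
  have form_eq (x y : ι × κ → ℝ) : x ⬝ᵥ Matrix.blockDiagonal B *ᵥ y =
      ∑ k, (fun i => x (i, k)) ⬝ᵥ B k *ᵥ (fun i => y (i, k)) := by
    simp only [dotProduct, mulVec, blockDiagonal_apply, Fintype.sum_prod_type_right, ite_mul,
      zero_mul]
    simp
  refine ⟨fun x => ?_, fun x y => ?_⟩
  · rw [form_eq]
    exact Finset.sum_nonneg fun k _ => (hB k).nonneg _
  · simp only [form_eq, ← Finset.sum_sub_distrib, ← Finset.sum_add_distrib, Finset.mul_sum]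
    exact (Finset.abs_sum_le_sum_abs _ _).trans
      (Finset.sum_le_sum fun k _ => (hB k).abs_sub_le _ _)

end HasSectorialForm

end SectorialForm

section GeneratingFunction

open Complex Matrix
open scoped Real

variable {m : ℕ} {s : ℝ → ℂ} {B : Matrix (Fin m) (Fin m) ℝ}

/-- The entries of `B` are Fourier coefficients of `s`, so `B` is the real Toeplitz matrix
generated by the symbol `s`. -/
def IsGeneratingFunction (s : ℝ → ℂ) (B : Matrix (Fin m) (Fin m) ℝ) : Prop :=
  ∀ j l : Fin m, ∫ θ in (0 : ℝ)..2 * π, s θ * exp (((l : ℕ) - (j : ℕ) : ℤ) * θ * I) =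
    2 * π * B j l

/-- The trigonometric polynomial `∑ z_l e^{ilθ}`. -/
noncomputable def trigPoly (z : Fin m → ℂ) (θ : ℝ) : ℂ :=
  ∑ l, z l * exp ((l : ℕ) * θ * I)

theorem continuous_trigPoly (z : Fin m → ℂ) : Continuous (trigPoly z) := by
  unfold trigPoly
  fun_prop

theorem normSq_trigPoly (z : Fin m → ℂ) (θ : ℝ) :
    (normSq (trigPoly z θ) : ℂ) =
      ∑ j, ∑ l, star (z j) * z l * exp (((l : ℕ) - (j : ℕ) : ℤ) * θ * I) := by
  rw [normSq_eq_conj_mul_self, trigPoly, map_sum, Finset.sum_mul_sum]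
  refine Finset.sum_congr rfl fun j _ => Finset.sum_congr rfl fun l _ => ?_
  rw [map_mul, ← exp_conj, mul_mul_mul_comm, ← exp_add]
  simp only [map_mul, conj_I, conj_ofReal, map_natCast, star_def]
  push_cast
  ring_nf

theorem IsGeneratingFunction.integral_mul_normSq_trigPoly (hB : IsGeneratingFunction s B)
    (hs : Continuous s) (z : Fin m → ℂ) :
    ∫ θ in (0 : ℝ)..2 * π, s θ * normSq (trigPoly z θ) =
      2 * π * (star z ⬝ᵥ B.map ofReal *ᵥ z) := by
  simp only [normSq_trigPoly, dotProduct, mulVec, Finset.mul_sum, Pi.star_apply]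
  rw [intervalIntegral.integral_finsetSum fun _ _ =>
    Continuous.intervalIntegrable (by fun_prop) _ _]
  refine Finset.sum_congr rfl fun j _ => ?_
  rw [intervalIntegral.integral_finsetSum fun _ _ =>
    Continuous.intervalIntegrable (by fun_prop) _ _]
  refine Finset.sum_congr rfl fun l _ => ?_
  simp only [mul_left_comm (s _)]
  rw [intervalIntegral.integral_const_mul, hB, map_apply]
  ring

theorem star_dotProduct_map_ofReal_mulVec {ι : Type*} [Fintype ι] (B : Matrix ι ι ℝ)
    (x y : ι → ℝ) :
    star (fun i => x i + y i * I : ι → ℂ) ⬝ᵥ B.map ofReal *ᵥ (fun i => x i + y i * I : ι → ℂ) =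
      (x ⬝ᵥ B *ᵥ x + y ⬝ᵥ B *ᵥ y : ℝ) + (x ⬝ᵥ B *ᵥ y - y ⬝ᵥ B *ᵥ x : ℝ) * I := by
  simp only [dotProduct, mulVec, map_apply, Pi.star_apply, star_def, map_add, map_mul, conj_ofReal,
    conj_I, Finset.mul_sum, ofReal_add, ofReal_sub, ofReal_sum, ofReal_mul, Finset.sum_mul,
    ← Finset.sum_add_distrib, ← Finset.sum_sub_distrib]
  refine Finset.sum_congr rfl fun j _ => Finset.sum_congr rfl fun l _ => ?_
  linear_combination (-y j * B j l * y l : ℂ) * I_mul_I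

theorem integral_re_nonneg_and_abs_im_le {F : ℝ → ℂ} {a b T : ℝ} (hab : a ≤ b)
    (hF : IntervalIntegrable F MeasureTheory.volume a b)
    (hFT : ∀ θ ∈ Set.Ioo a b, 0 ≤ (F θ).re ∧ |(F θ).im| ≤ T * (F θ).re) :
    0 ≤ (∫ θ in a..b, F θ).re ∧ |(∫ θ in a..b, F θ).im| ≤ T * (∫ θ in a..b, F θ).re := by
  have hre : IntervalIntegrable (fun θ => (F θ).re) MeasureTheory.volume a b :=
    ⟨hF.1.re, hF.2.re⟩
  have him : IntervalIntegrable (fun θ => (F θ).im) MeasureTheory.volume a b :=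
    ⟨hF.1.im, hF.2.im⟩
  have re_integral : (∫ θ in a..b, F θ).re = ∫ θ in a..b, (F θ).re :=
    (reCLM.intervalIntegral_comp_comm hF).symm
  have im_integral : (∫ θ in a..b, F θ).im = ∫ θ in a..b, (F θ).im :=
    (imCLM.intervalIntegral_comp_comm hF).symm
  rw [re_integral, im_integral]
  constructor
  · rw [intervalIntegral.integral_of_le hab, MeasureTheory.integral_Ioc_eq_integral_Ioo]
    exact MeasureTheory.setIntegral_nonneg measurableSet_Ioo fun θ hθ => (hFT θ hθ).1
  · calc |∫ θ in a..b, (F θ).im| ≤ ∫ θ in a..b, |(F θ).im| :=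
        intervalIntegral.abs_integral_le_integral_abs hab
      _ ≤ ∫ θ in a..b, T * (F θ).re :=
        intervalIntegral.integral_mono_on_of_le_Ioo hab him.abs (hre.const_mul T)
          fun θ hθ => (hFT θ hθ).2
      _ = T * ∫ θ in a..b, (F θ).re := intervalIntegral.integral_const_mul _ _

theorem IsGeneratingFunction.hasSectorialForm (hB : IsGeneratingFunction s B)
    (hs : Continuous s) {T : ℝ}
    (hsT : ∀ θ ∈ Set.Ioo 0 (2 * π), 0 ≤ (s θ).re ∧ |(s θ).im| ≤ T * (s θ).re) :
    HasSectorialForm T B := by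
  have form_mem_sector (x y : Fin m → ℝ) : 0 ≤ x ⬝ᵥ B *ᵥ x + y ⬝ᵥ B *ᵥ y ∧
      |x ⬝ᵥ B *ᵥ y - y ⬝ᵥ B *ᵥ x| ≤ T * (x ⬝ᵥ B *ᵥ x + y ⬝ᵥ B *ᵥ y) := by
    set z : Fin m → ℂ := fun i => x i + y i * I
    have hcont : Continuous fun θ => s θ * (normSq (trigPoly z θ) : ℂ) :=
      hs.mul (continuous_ofReal.comp (continuous_normSq.comp (continuous_trigPoly z)))
    have hint := integral_re_nonneg_and_abs_im_le Real.two_pi_pos.le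
      (hcont.intervalIntegrable _ _) (T := T) fun θ hθ => by
        rw [re_mul_ofReal, im_mul_ofReal, abs_mul, abs_of_nonneg (normSq_nonneg _), ← mul_assoc]
        exact ⟨mul_nonneg (hsT θ hθ).1 (normSq_nonneg _),
          mul_le_mul_of_nonneg_right (hsT θ hθ).2 (normSq_nonneg _)⟩
    have h2π : (2 * π : ℂ) = (2 * π : ℝ) := by push_cast; rfl
    rw [hB.integral_mul_normSq_trigPoly hs, star_dotProduct_map_ofReal_mulVec, h2π,
      re_ofReal_mul, im_ofReal_mul, abs_mul, abs_of_pos Real.two_pi_pos, mul_left_comm] at hint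
    simpa using hint.imp (nonneg_of_mul_nonneg_right · Real.two_pi_pos)
      (le_of_mul_le_mul_left · Real.two_pi_pos)
  exact ⟨fun x => by simpa using (form_mem_sector x 0).1, fun x y => (form_mem_sector x y).2⟩

theorem isGeneratingFunction_grunwaldSymbol {α : ℝ} (hα : 0 < α) (m : ℕ) :
    IsGeneratingFunction (grunwaldSymbol α) (grunwaldMatrix α m) := fun j l => by
  rw [integral_grunwaldSymbol_mul_exp hα, grunwaldMatrix, of_apply]
  split_ifs
  · rw [show (1 - ((l : ℕ) - (j : ℕ) : ℤ)).toNat = (j : ℕ) + 1 - l by omega, ofReal_neg]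
  · omega
  · omega
  · rw [ofReal_zero]

theorem hasSectorialForm_grunwaldMatrix {α : ℝ} (hα : 1 < α ∧ α < 3) (m : ℕ) :
    HasSectorialForm |Real.tan (α / 2 * π)| (grunwaldMatrix α m) :=
  have hα₀ : 0 < α := zero_lt_one.trans hα.1
  (isGeneratingFunction_grunwaldSymbol hα₀ m).hasSectorialForm (continuous_grunwaldSymbol hα₀)
    fun _ => grunwaldSymbol_re_nonneg_and_abs_im_le hα

end GeneratingFunction

section Kronecker

open Matrix

variable {d : ℕ} {n : Fin d → ℕ}

theorem kroneckerProd_mul (M N : (i : Fin d) → Matrix (Fin (n i)) (Fin (n i)) ℝ) :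
    kroneckerProd M * kroneckerProd N = kroneckerProd fun i => M i * N i := by
  ext j l
  simp only [kroneckerProd, Matrix.mul_apply, of_apply, Finset.prod_univ_sum,
    Fintype.piFinset_univ, Finset.prod_mul_distrib]

theorem kroneckerProd_transpose (M : (i : Fin d) → Matrix (Fin (n i)) (Fin (n i)) ℝ) :
    (kroneckerProd M)ᵀ = kroneckerProd fun i => (M i)ᵀ :=
  rfl

theorem kroneckerProd_one :
    kroneckerProd (fun i => (1 : Matrix (Fin (n i)) (Fin (n i)) ℝ)) = 1 := by
  ext j l
  simp only [kroneckerProd, of_apply, Matrix.one_apply, Finset.prod_ite_zero, Finset.prod_const_one,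
    Finset.mem_univ, true_imp_iff, funext_iff]

theorem inDirection_eq_submatrix_blockDiagonal (i : Fin d)
    (B : Matrix (Fin (n i)) (Fin (n i)) ℝ) :
    inDirection i B = (blockDiagonal fun _ => B).submatrix (Equiv.piSplitAt i fun j => Fin (n j))
      (Equiv.piSplitAt i fun j => Fin (n j)) := by
  ext j l
  rw [inDirection, kroneckerProd, of_apply, submatrix_apply, blockDiagonal_apply]
  split_ifs with h
  · have hjl (k : Fin d) (hk : k ≠ i) : j k = l k := congrFun h ⟨k, hk⟩
    rw [Finset.prod_eq_single i]
    · simp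
    · intro k _ hk
      rw [Function.update_of_ne hk, hjl k hk, one_apply_eq]
    · simp
  · obtain ⟨k, hk⟩ := Function.ne_iff.mp h
    refine Finset.prod_eq_zero (Finset.mem_univ k.1) ?_
    rw [Function.update_of_ne k.2]
    exact one_apply_ne hk

theorem HasSectorialForm.inDirection {T : ℝ} {i : Fin d} {B : Matrix (Fin (n i)) (Fin (n i)) ℝ}
    (hB : HasSectorialForm T B) : HasSectorialForm T (inDirection i B) := by
  rw [inDirection_eq_submatrix_blockDiagonal]
  exact (HasSectorialForm.blockDiagonal fun _ => hB).submatrix _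

end Kronecker

section AntiIdentity

open Matrix

variable {d : ℕ} {n : Fin d → ℕ} {m : ℕ}

theorem antiIdentity_eq_submatrix_one :
    antiIdentity m = (1 : Matrix (Fin m) (Fin m) ℝ).submatrix Fin.revPerm (Equiv.refl _) := by
  ext j l
  rw [antiIdentity, of_apply, submatrix_apply, one_apply]
  congr 1
  rw [Fin.revPerm_apply, Equiv.refl_apply, Fin.ext_iff, Fin.val_rev, eq_iff_iff]
  omega

theorem antiIdentity_transpose : (antiIdentity m)ᵀ = antiIdentity m := by
  ext j l
  simp only [antiIdentity, transpose_apply, of_apply, add_comm]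

theorem antiIdentity_mul_mul_antiIdentity (B : Matrix (Fin m) (Fin m) ℝ) :
    antiIdentity m * B * antiIdentity m = B.submatrix Fin.rev Fin.rev := by
  rw [antiIdentity_eq_submatrix_one]
  rw [mul_submatrix_one, one_submatrix_mul]
  rfl

theorem antiIdentity_mul_self : antiIdentity m * antiIdentity m = 1 := by
  have h := antiIdentity_mul_mul_antiIdentity (1 : Matrix (Fin m) (Fin m) ℝ)
  rwa [Matrix.mul_one, submatrix_one _ Fin.rev_injective] at h

theorem antiIdentity_mul_grunwaldMatrix_mul_antiIdentity (α : ℝ) (m : ℕ) :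
    antiIdentity m * grunwaldMatrix α m * antiIdentity m = (grunwaldMatrix α m)ᵀ := by
  rw [antiIdentity_mul_mul_antiIdentity]
  ext j l
  simp only [grunwaldMatrix, submatrix_apply, transpose_apply, of_apply, Fin.val_rev]
  split_ifs
  · congr 2
    omega
  · omega
  · omega
  · rfl

theorem multiAntiIdentity_transpose : (multiAntiIdentity n)ᵀ = multiAntiIdentity n := by
  simp only [multiAntiIdentity, kroneckerProd_transpose, antiIdentity_transpose]

theorem multiAntiIdentity_mul_self : multiAntiIdentity n * multiAntiIdentity n = 1 := by
  simp only [multiAntiIdentity, kroneckerProd_mul, antiIdentity_mul_self, kroneckerProd_one]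

theorem multiAntiIdentity_mul_inDirection_mul_multiAntiIdentity {i : Fin d}
    {B : Matrix (Fin (n i)) (Fin (n i)) ℝ}
    (hB : antiIdentity (n i) * B * antiIdentity (n i) = Bᵀ) :
    multiAntiIdentity n * inDirection i B * multiAntiIdentity n = (inDirection i B)ᵀ := by
  rw [multiAntiIdentity, inDirection, kroneckerProd_mul, kroneckerProd_mul, kroneckerProd_transpose]
  congr 1 with k : 1
  rcases eq_or_ne k i with rfl | hk
  · rw [Function.update_self, hB]
  · rw [Function.update_of_ne hk, Matrix.mul_one, antiIdentity_mul_self, transpose_one]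

end AntiIdentity

section Scheme

open Matrix

variable {d : ℕ} {n : Fin d → ℕ} (α dp dm : Fin d → ℝ) (τ : ℝ) (a b : Fin d → ℝ)

theorem multiAntiIdentity_mul_schemeMatrix_mul_multiAntiIdentity :
    multiAntiIdentity n * schemeMatrix α dp dm τ a b n * multiAntiIdentity n =
      (schemeMatrix α dp dm τ a b n)ᵀ := by
  have hW (i : Fin d) := multiAntiIdentity_mul_inDirection_mul_multiAntiIdentity
    (antiIdentity_mul_grunwaldMatrix_mul_antiIdentity (α i) (n i))
  have hWt (i : Fin d) : multiAntiIdentity n * (inDirection i (grunwaldMatrix (α i) (n i)))ᵀ *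
      multiAntiIdentity n = inDirection i (grunwaldMatrix (α i) (n i)) := by
    simpa only [transpose_mul, multiAntiIdentity_transpose, transpose_transpose,
      ← Matrix.mul_assoc] using congrArg transpose (hW i)
  simp only [schemeMatrix, Matrix.mul_add, Matrix.add_mul, Matrix.mul_smul, Matrix.smul_mul,
    Matrix.mul_sum, Matrix.sum_mul, Matrix.mul_one, multiAntiIdentity_mul_self, hW, hWt,
    transpose_add, transpose_smul, transpose_sum, transpose_one, transpose_transpose]

theorem isSymm_multiAntiIdentity_mul_schemeMatrix :
    (multiAntiIdentity n * schemeMatrix α dp dm τ a b n).IsSymm := by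
  rw [Matrix.IsSymm, transpose_mul, multiAntiIdentity_transpose,
    ← multiAntiIdentity_mul_schemeMatrix_mul_multiAntiIdentity, Matrix.mul_assoc,
    multiAntiIdentity_mul_self, Matrix.mul_one]

variable {α dp dm τ a b}

theorem asymmetryBound_nonneg (hsum : ∀ i, 0 < dp i + dm i) : 0 ≤ asymmetryBound α dp dm :=
  Real.iSup_nonneg fun i => mul_nonneg (div_nonneg (abs_nonneg _) (hsum i).le) (abs_nonneg _)

theorem abs_sub_mul_abs_tan_le_asymmetryBound_mul (hsum : ∀ i, 0 < dp i + dm i) (i : Fin d) :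
    |dp i - dm i| * |Real.tan (α i / 2 * Real.pi)| ≤ asymmetryBound α dp dm * (dp i + dm i) := by
  have hi : |dp i - dm i| / (dp i + dm i) * |Real.tan (α i / 2 * Real.pi)| ≤
      asymmetryBound α dp dm :=
    le_ciSup (f := fun i => |dp i - dm i| / (dp i + dm i) * |Real.tan (α i / 2 * Real.pi)|)
      (Set.finite_range _).bddAbove i
  rwa [div_mul_eq_mul_div, div_le_iff₀ (hsum i)] at hi

theorem stepSize_rpow_pos (hab : ∀ i, a i < b i) (i : Fin d) (s : ℝ) :
    0 < stepSize a b n i ^ s :=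
  Real.rpow_pos_of_pos (div_pos (sub_pos.mpr (hab i)) (n i).cast_add_one_pos) s

theorem exists_schemeMatrix_eq_add (hα : ∀ i, 1 < α i ∧ α i < 3) (hsum : ∀ i, 0 < dp i + dm i)
    (hab : ∀ i, a i < b i) :
    ∃ C, HasSectorialForm (asymmetryBound α dp dm) C ∧
      schemeMatrix α dp dm τ a b n = (1 / τ) • (1 : Matrix (Grid n) (Grid n) ℝ) + C := by
  refine ⟨_, .sum fun i _ => ?_, rfl⟩
  have hh := stepSize_rpow_pos (n := n) hab i (α i)
  refine (hasSectorialForm_grunwaldMatrix (hα i) (n i)).inDirection.smul_add_smul_transpose ?_ ?_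
  · rw [← add_div]
    exact (div_pos (hsum i) hh).le
  · rw [← sub_div, ← add_div, abs_div, abs_of_pos hh, div_mul_eq_mul_div, mul_div_assoc']
    exact div_le_div_of_nonneg_right (abs_sub_mul_abs_tan_le_asymmetryBound_mul hsum i) hh.le

theorem hasSectorialForm_schemeMatrix (hα : ∀ i, 1 < α i ∧ α i < 3)
    (hsum : ∀ i, 0 < dp i + dm i) (hτ : 0 < τ) (hab : ∀ i, a i < b i) :
    HasSectorialForm (asymmetryBound α dp dm) (schemeMatrix α dp dm τ a b n) := by
  obtain ⟨C, hC, hA⟩ := exists_schemeMatrix_eq_add hα hsum hab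
  rw [hA]
  exact ((HasSectorialForm.one (asymmetryBound_nonneg hsum)).smul (by positivity)).add hC

theorem schemeMatrix_form_pos (hα : ∀ i, 1 < α i ∧ α i < 3) (hsum : ∀ i, 0 < dp i + dm i)
    (hτ : 0 < τ) (hab : ∀ i, a i < b i) {x : Grid n → ℝ} (hx : x ≠ 0) :
    0 < x ⬝ᵥ schemeMatrix α dp dm τ a b n *ᵥ x := by
  obtain ⟨C, hC, hA⟩ := exists_schemeMatrix_eq_add hα hsum hab
  have hxx : 0 < x ⬝ᵥ x := by simpa using dotProduct_star_self_pos_iff.mpr hx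
  rw [hA, add_mulVec, smul_mulVec, one_mulVec, dotProduct_add, dotProduct_smul, smul_eq_mul]
  exact add_pos_of_pos_of_nonneg (by positivity) (hC.nonneg x)

end Scheme

section SymmetricSkew

open Matrix

variable {ι : Type*}

/-- The skew-symmetric part `(A - Aᵀ) / 2`, the counterpart of `symmPart`. -/
noncomputable def skewPart (A : Matrix ι ι ℝ) : Matrix ι ι ℝ :=
  (1 / 2 : ℝ) • (A - Aᵀ)

theorem symmPart_add_skewPart (A : Matrix ι ι ℝ) : symmPart A + skewPart A = A := by
  rw [symmPart, skewPart, ← smul_add, add_add_sub_cancel, ← two_smul ℝ A, smul_smul]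
  norm_num

variable [Fintype ι] {A Y : Matrix ι ι ℝ} {T μ : ℝ}

theorem dotProduct_symmPart_mulVec (A : Matrix ι ι ℝ) (x y : ι → ℝ) :
    x ⬝ᵥ symmPart A *ᵥ y = (x ⬝ᵥ A *ᵥ y + y ⬝ᵥ A *ᵥ x) / 2 := by
  rw [symmPart, smul_mulVec, add_mulVec, dotProduct_smul, dotProduct_add,
    dotProduct_transpose_mulVec, smul_eq_mul, one_div_mul_eq_div]

theorem dotProduct_skewPart_mulVec (A : Matrix ι ι ℝ) (x y : ι → ℝ) :
    x ⬝ᵥ skewPart A *ᵥ y = (x ⬝ᵥ A *ᵥ y - y ⬝ᵥ A *ᵥ x) / 2 := by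
  rw [skewPart, smul_mulVec, sub_mulVec, dotProduct_smul, dotProduct_sub,
    dotProduct_transpose_mulVec, smul_eq_mul, one_div_mul_eq_div]

theorem posDef_symmPart (hA : ∀ x : ι → ℝ, x ≠ 0 → 0 < x ⬝ᵥ A *ᵥ x) : (symmPart A).PosDef := by
  refine PosDef.of_dotProduct_mulVec_pos ?_ fun x hx => ?_
  · rw [isHermitian_iff_isSymm, Matrix.IsSymm, symmPart, transpose_smul, transpose_add,
      transpose_transpose, add_comm]
  · rw [star_trivial, dotProduct_symmPart_mulVec]
    linarith [hA x hx]

theorem HasSectorialForm.dotProduct_skewPart_mulVec_sq_le (hA : HasSectorialForm T A)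
    (x y : ι → ℝ) : (x ⬝ᵥ skewPart A *ᵥ y) ^ 2 ≤
      T ^ 2 * ((x ⬝ᵥ symmPart A *ᵥ x) * (y ⬝ᵥ symmPart A *ᵥ y)) := by
  have quadratic_nonneg (c : ℝ) : 0 ≤ T * (x ⬝ᵥ symmPart A *ᵥ x) * (c * c) +
      -2 * (x ⬝ᵥ skewPart A *ᵥ y) * c + T * (y ⬝ᵥ symmPart A *ᵥ y) := by
    have h := (le_abs_self _).trans (hA.abs_sub_le (c • x) y)
    simp only [mulVec_smul, dotProduct_smul, smul_dotProduct, smul_eq_mul] at h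
    simp only [dotProduct_symmPart_mulVec, dotProduct_skewPart_mulVec]
    linarith
  have hdiscrim := discrim_le_zero quadratic_nonneg
  rw [discrim] at hdiscrim
  linarith

variable [DecidableEq ι]

theorem sq_mul_one_add_eq_one_sub_sq {R : Type*} [Ring R] {y p : R} (hy : y * y = 1)
    (hyp : y * p = -(p * y)) : (y * (1 + p)) ^ 2 = 1 - p ^ 2 := by
  calc (y * (1 + p)) ^ 2 = (y * y + y * p * y) * (1 + p) := by noncomm_ring
    _ = (1 - p) * (1 + p) := by
        rw [hyp, neg_mul, mul_assoc, hy, mul_one, sub_eq_add_neg]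
    _ = 1 - p ^ 2 := by noncomm_ring

theorem inv_symmPart_mul_mul_sq (hH : (symmPart A).PosDef) (hY : Y * Y = 1)
    (hYA : Y * A * Y = Aᵀ) :
    ((symmPart A)⁻¹ * (Y * A)) ^ 2 = 1 - ((symmPart A)⁻¹ * skewPart A) ^ 2 := by
  set H := symmPart A with hH_def
  set S := skewPart A with hS_def
  have hunit : IsUnit H.det := (isUnit_iff_isUnit_det H).mp hH.isUnit
  have hYAt : Y * A = Aᵀ * Y := by rw [← hYA, Matrix.mul_assoc _ Y, hY, Matrix.mul_one]
  have hYAt' : Y * Aᵀ = A * Y := by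
    rw [← hYA, Matrix.mul_assoc Y, ← Matrix.mul_assoc Y Y, hY, Matrix.one_mul]
  have hYH : Y * H = H * Y := by
    rw [hH_def, symmPart, Matrix.mul_smul, Matrix.smul_mul, Matrix.mul_add, Matrix.add_mul, hYAt,
      hYAt', add_comm]
  have hYS : Y * S = -(S * Y) := by
    rw [hS_def, skewPart, Matrix.mul_smul, Matrix.smul_mul, Matrix.mul_sub, Matrix.sub_mul, hYAt,
      hYAt', ← smul_neg, neg_sub]
  have hYH' : H⁻¹ * Y = Y * H⁻¹ := by
    rw [← mul_nonsing_inv_cancel_right H (H⁻¹ * Y) hunit, Matrix.mul_assoc H⁻¹, hYH,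
      nonsing_inv_mul_cancel_left _ _ hunit]
  have hYP : Y * (H⁻¹ * S) = -(H⁻¹ * S * Y) := by
    rw [← Matrix.mul_assoc, ← hYH', Matrix.mul_assoc, hYS, Matrix.mul_neg, Matrix.mul_assoc]
  rw [← sq_mul_one_add_eq_one_sub_sq hY hYP, ← Matrix.mul_assoc, hYH', Matrix.mul_assoc,
    ← symmPart_add_skewPart A, Matrix.mul_add, nonsing_inv_mul _ hunit]

theorem exists_mulVec_eq_smul_of_mem_spectrum {F : Type*} [Field F] {M : Matrix ι ι F} {μ : F}
    (hμ : μ ∈ spectrum F M) : ∃ v ≠ 0, M *ᵥ v = μ • v := by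
  rw [← spectrum_toLin', ← Module.End.hasEigenvalue_iff_mem_spectrum] at hμ
  obtain ⟨v, hv⟩ := hμ.exists_hasEigenvector
  exact ⟨v, hv.2, hv.apply_eq_smul⟩

theorem HasSectorialForm.mem_Icc_of_skewPart_eigenvector (hA : HasSectorialForm T A)
    (hH : (symmPart A).PosDef) {v : ι → ℝ} (hv : v ≠ 0) {s : ℝ}
    (hvs : ((symmPart A)⁻¹ * skewPart A) ^ 2 *ᵥ v = -s • v) : s ∈ Set.Icc 0 (T ^ 2) := by
  set H := symmPart A with hH_def
  set S := skewPart A with hS_def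
  set w := (H⁻¹ * S) *ᵥ v
  have hunit : IsUnit H.det := (isUnit_iff_isUnit_det H).mp hH.isUnit
  have hHw (x : ι → ℝ) : H *ᵥ (H⁻¹ * S) *ᵥ x = S *ᵥ x := by
    rw [mulVec_mulVec, mul_nonsing_inv_cancel_left _ _ hunit]
  have hSw : S *ᵥ w = -s • H *ᵥ v := by
    rw [← hHw, mulVec_mulVec v, ← sq, hvs, mulVec_smul]
  have hvv : 0 < v ⬝ᵥ H *ᵥ v := by simpa using hH.dotProduct_mulVec_pos hv
  have hww : w ⬝ᵥ H *ᵥ w = s * (v ⬝ᵥ H *ᵥ v) := by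
    calc w ⬝ᵥ H *ᵥ w = w ⬝ᵥ S *ᵥ v := by rw [hHw]
      _ = -(v ⬝ᵥ S *ᵥ w) := by
          rw [hS_def, dotProduct_skewPart_mulVec, dotProduct_skewPart_mulVec]
          ring
      _ = s * (v ⬝ᵥ H *ᵥ v) := by rw [hSw, dotProduct_smul, smul_eq_mul, neg_mul, neg_neg]
  have hww₀ : 0 ≤ w ⬝ᵥ H *ᵥ w := by simpa using hH.posSemidef.dotProduct_mulVec_nonneg w
  have hs : 0 ≤ s := nonneg_of_mul_nonneg_left (hww ▸ hww₀) hvv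
  refine ⟨hs, ?_⟩
  have hbound : (s * (v ⬝ᵥ H *ᵥ v)) ^ 2 ≤ T ^ 2 * (s * (v ⬝ᵥ H *ᵥ v) * (v ⬝ᵥ H *ᵥ v)) := by
    have h := hA.dotProduct_skewPart_mulVec_sq_le w v
    rwa [← hS_def, ← hH_def, ← hHw v, hww] at h
  rcases hs.eq_or_lt with rfl | hs
  · positivity
  · refine le_of_mul_le_mul_right ?_ (mul_pos hs (pow_pos hvv 2))
    linarith

theorem HasSectorialForm.sq_mem_Icc_of_mem_spectrum (hA : HasSectorialForm T A)
    (hH : (symmPart A).PosDef) (hY : Y * Y = 1) (hYA : Y * A * Y = Aᵀ)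
    (hμ : μ ∈ spectrum ℝ ((symmPart A)⁻¹ * (Y * A))) : μ ^ 2 ∈ Set.Icc 1 (1 + T ^ 2) := by
  obtain ⟨v, hv, hMv⟩ := exists_mulVec_eq_smul_of_mem_spectrum hμ
  have hvs : ((symmPart A)⁻¹ * skewPart A) ^ 2 *ᵥ v = -(μ ^ 2 - 1) • v := by
    rw [← sub_sub_cancel 1 (((symmPart A)⁻¹ * skewPart A) ^ 2), ← inv_symmPart_mul_mul_sq hH hY hYA,
      sub_mulVec, one_mulVec, sq, ← mulVec_mulVec, hMv, mulVec_smul, hMv, smul_smul, ← sq]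
    module
  have h := hA.mem_Icc_of_skewPart_eigenvector hH hv hvs
  constructor <;> linarith [h.1, h.2]

end SymmetricSkew

section Pencil

open Matrix
open scoped ComplexOrder MatrixOrder

variable {ι : Type*} [Fintype ι] [DecidableEq ι]

theorem exists_simultaneous_diagonalization {𝕜 : Type*} [RCLike 𝕜] {H K : Matrix ι ι 𝕜}
    (hH : H.PosDef) (hK : K.IsHermitian) :
    ∃ (V : Matrix ι ι 𝕜) (d : ι → ℝ),
      Vᴴ * H * V = 1 ∧ Vᴴ * K * V = diagonal (fun i => (d i : 𝕜)) := by
  obtain ⟨B, hB, hHB⟩ :=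
    CStarAlgebra.isStrictlyPositive_iff_eq_star_mul_self.mp hH.isStrictlyPositive
  rw [star_eq_conjTranspose] at hHB
  have hBB : B * B⁻¹ = 1 := mul_nonsing_inv B ((isUnit_iff_isUnit_det B).mp hB)
  have hBH : B⁻¹ᴴ * Bᴴ = 1 := by rw [← conjTranspose_mul, hBB, conjTranspose_one]
  have hK' : (B⁻¹ᴴ * K * B⁻¹).IsHermitian := isHermitian_conjTranspose_mul_mul B⁻¹ hK
  let U : Matrix ι ι 𝕜 := hK'.eigenvectorUnitary
  have hU : Uᴴ * U = 1 := Unitary.coe_star_mul_self hK'.eigenvectorUnitary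
  refine ⟨B⁻¹ * U, hK'.eigenvalues, ?_, ?_⟩
  · calc (B⁻¹ * U)ᴴ * H * (B⁻¹ * U) = Uᴴ * ((B⁻¹ᴴ * Bᴴ) * (B * B⁻¹)) * U := by
          simp only [hHB, conjTranspose_mul, Matrix.mul_assoc]
      _ = 1 := by rw [hBH, hBB, Matrix.mul_one, Matrix.mul_one, hU]
  · calc (B⁻¹ * U)ᴴ * K * (B⁻¹ * U) = Uᴴ * (B⁻¹ᴴ * K * B⁻¹) * U := by
          simp only [conjTranspose_mul, Matrix.mul_assoc]
      _ = diagonal (RCLike.ofReal ∘ hK'.eigenvalues) := by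
          rw [← hK'.conjStarAlgAut_star_eigenvectorUnitary, Unitary.conjStarAlgAut_star_apply]
          rfl

theorem exists_diagonalization_inv_mul {𝕜 : Type*} [RCLike 𝕜] {H K : Matrix ι ι 𝕜}
    (hH : H.PosDef) (hK : K.IsHermitian) :
    ∃ (V : Matrix ι ι 𝕜) (d : ι → ℝ),
      Vᴴ * H * V = 1 ∧ H⁻¹ * K * V = V * diagonal (fun i => (d i : 𝕜)) := by
  obtain ⟨V, d, hV, hVK⟩ := exists_simultaneous_diagonalization hH hK
  have hinv : H⁻¹ = V * Vᴴ := inv_eq_left_inv <| by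
    rw [Matrix.mul_assoc]
    exact mul_eq_one_comm.mp hV
  exact ⟨V, d, hV, by rw [hinv, ← hVK]; simp only [Matrix.mul_assoc]⟩

theorem spectrum_eq_range_of_mul_eq_mul_diagonal {F : Type*} [Field F] {M V : Matrix ι ι F}
    {d : ι → F} (hV : IsUnit V) (hMV : M * V = V * diagonal d) :
    spectrum F M = Set.range d := by
  obtain ⟨u, rfl⟩ := hV
  rw [← spectrum_diagonal d, ← spectrum.units_conjugate (a := diagonal d) (u := u), ← hMV,
    Matrix.mul_assoc, ← Units.val_mul, mul_inv_cancel, Units.val_one, Matrix.mul_one]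

theorem aeval_mul_eq_mul_diagonal {R : Type*} [CommRing R] {M V : Matrix ι ι R} {d : ι → R}
    (hMV : M * V = V * diagonal d) (p : Polynomial R) :
    Polynomial.aeval M p * V = V * diagonal fun i => p.eval (d i) := by
  have hsemiconj : SemiconjBy V (Polynomial.aeval (diagonal d) p) (Polynomial.aeval M p) := by
    induction p using Polynomial.induction_on' with
    | add p q hp hq => simpa only [map_add] using hp.add_right hq
    | monomial k a =>
      have hpow : SemiconjBy V (diagonal d ^ k) (M ^ k) := SemiconjBy.pow_right hMV.symm k
      simp only [Polynomial.aeval_monomial]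
      exact SemiconjBy.mul_right (Algebra.commutes a V).symm hpow
  have haeval : Polynomial.aeval (diagonal d) p = diagonal fun i => p.eval (d i) := by
    rw [← diagonalAlgHom_apply (R := R) d, Polynomial.aeval_algHom_apply, diagonalAlgHom_apply]
    congr 1 with i
    simp
  rw [← haeval]
  exact hsemiconj.eq.symm

variable {H K : Matrix ι ι ℝ}

theorem spectrum_map_inv_mul (hH : H.PosDef) (hK : K.IsHermitian) :
    spectrum ℂ ((H⁻¹ * K).map (algebraMap ℝ ℂ)) = algebraMap ℝ ℂ '' spectrum ℝ (H⁻¹ * K) := by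
  obtain ⟨V, d, hV, hKV⟩ := exists_diagonalization_inv_mul hH hK
  have hunit : IsUnit V := .of_mul_eq_one_right _ hV
  have hKV' : (H⁻¹ * K).map (algebraMap ℝ ℂ) * V.map (algebraMap ℝ ℂ) =
      V.map (algebraMap ℝ ℂ) * diagonal (algebraMap ℝ ℂ ∘ d) := by
    rw [← Matrix.map_mul, hKV, Matrix.map_mul, diagonal_map (map_zero _)]
    rfl
  rw [spectrum_eq_range_of_mul_eq_mul_diagonal (hunit.map (algebraMap ℝ ℂ).mapMatrix) hKV',
    spectrum_eq_range_of_mul_eq_mul_diagonal hunit hKV, Set.range_comp]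
  rfl

theorem energyNorm_mulVec {V : Matrix ι ι ℝ} (hV : Vᴴ * H * V = 1) (c : ι → ℝ) :
    energyNorm H (V *ᵥ c) = √(c ⬝ᵥ c) := by
  have h : (V *ᵥ c) ⬝ᵥ H *ᵥ V *ᵥ c = c ⬝ᵥ (Vᴴ * H * V) *ᵥ c := by
    rw [conjTranspose_eq_transpose_of_trivial, ← mulVec_mulVec, ← mulVec_mulVec,
      dotProduct_transpose_mulVec, dotProduct_comm]
  rw [energyNorm, h, hV, one_mulVec]

theorem energyNorm_aeval_le (hH : H.PosDef) (hK : K.IsHermitian) {p : Polynomial ℝ} {C : ℝ}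
    (hC : 0 ≤ C) (hp : ∀ μ ∈ spectrum ℝ (H⁻¹ * K), |p.eval μ| ≤ C) (r : ι → ℝ) :
    energyNorm H (Polynomial.aeval (H⁻¹ * K) p *ᵥ r) ≤ C * energyNorm H r := by
  obtain ⟨V, d, hV, hKV⟩ := exists_diagonalization_inv_mul hH hK
  have hunit : IsUnit V := .of_mul_eq_one_right _ hV
  have hspec (i : ι) : d i ∈ spectrum ℝ (H⁻¹ * K) := by
    rw [spectrum_eq_range_of_mul_eq_mul_diagonal hunit hKV]
    exact ⟨i, rfl⟩
  obtain ⟨c, rfl⟩ := mulVec_surjective_iff_isUnit.mpr hunit r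
  rw [mulVec_mulVec, aeval_mul_eq_mul_diagonal hKV, ← mulVec_mulVec, energyNorm_mulVec hV,
    energyNorm_mulVec hV, ← Real.sqrt_sq hC, ← Real.sqrt_mul (sq_nonneg C)]
  refine Real.sqrt_le_sqrt ?_
  simp only [dotProduct, mulVec_diagonal, Finset.mul_sum]
  refine Finset.sum_le_sum fun i _ => ?_
  rw [mul_mul_mul_comm, ← sq, ← sq_abs]
  exact mul_le_mul_of_nonneg_right (pow_le_pow_left₀ (abs_nonneg _) (hp _ (hspec i)) 2)
    (mul_self_nonneg _)

end Pencil

section Minres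

open Matrix Polynomial

variable {ι : Type*} [Fintype ι] [DecidableEq ι]

theorem aeval_mulVec_mem_krylov (M : Matrix ι ι ℝ) (z : ι → ℝ) {k : ℕ} {p : ℝ[X]}
    (hp : p.degree < k) : aeval M p *ᵥ z ∈ krylov M z k := by
  rw [aeval_eq_sum_range, sum_mulVec]
  refine Submodule.sum_mem _ fun j _ => ?_
  rw [smul_mulVec]
  by_cases hj : j < k
  · exact Submodule.smul_mem _ _ (Submodule.subset_span ⟨⟨j, hj⟩, rfl⟩)
  · rw [(degree_lt_iff_coeff_zero p k).mp hp j (not_lt.mp hj), zero_smul]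
    exact Submodule.zero_mem _

theorem precondResidual_add (P K : Matrix ι ι ℝ) (c u w : ι → ℝ) :
    precondResidual P K c (u + w) = precondResidual P K c u - (P⁻¹ * K) *ᵥ w := by
  rw [precondResidual, precondResidual, mulVec_add, sub_add_eq_sub_sub]

theorem exists_precondResidual_eq_aeval (P K : Matrix ι ι ℝ) (c u₀ : ι → ℝ) {k : ℕ} {p : ℝ[X]}
    (hp₀ : p.eval 0 = 1) (hpk : p.natDegree ≤ k) :
    ∃ v, v - u₀ ∈ krylov (P⁻¹ * K) (precondResidual P K c u₀) k ∧
      precondResidual P K c v = aeval (P⁻¹ * K) p *ᵥ precondResidual P K c u₀ := by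
  set z := precondResidual P K c u₀ with hz
  have hp : p = X * p.divX + 1 := by
    rw [← coeff_zero_eq_eval_zero] at hp₀
    simpa [hp₀] using (X_mul_divX_add p).symm
  have hdegree : (-p.divX).degree < k := by
    have hp_ne : p ≠ 0 := by
      rintro rfl
      simp at hp₀
    rw [degree_neg]
    exact (degree_divX_lt hp_ne).trans_le (degree_le_of_natDegree_le hpk)
  refine ⟨u₀ + aeval (P⁻¹ * K) (-p.divX) *ᵥ z, ?_, ?_⟩
  · rw [add_sub_cancel_left]
    exact aeval_mulVec_mem_krylov _ _ hdegree
  · conv_rhs => rw [hp]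
    rw [precondResidual_add, ← hz, map_neg, neg_mulVec, mulVec_neg, sub_neg_eq_add, map_add,
      map_mul, aeval_X, map_one, add_mulVec, one_mulVec, mulVec_mulVec, add_comm]

theorem energyNorm_minres_le {H K : Matrix ι ι ℝ} (hH : H.PosDef) (hK : K.IsHermitian)
    {c u₀ u : ι → ℝ} {k : ℕ} (hu : IsMinresIterate H K c u₀ k u) {p : ℝ[X]}
    (hp₀ : p.eval 0 = 1) (hpk : p.natDegree ≤ k) {C : ℝ} (hC : 0 ≤ C)
    (hp : ∀ μ ∈ spectrum ℝ (H⁻¹ * K), |p.eval μ| ≤ C) :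
    energyNorm H (precondResidual H K c u) ≤ C * energyNorm H (precondResidual H K c u₀) := by
  obtain ⟨v, hv, hres⟩ := exists_precondResidual_eq_aeval H K c u₀ hp₀ hpk
  exact (hu.2 v hv).trans (hres ▸ energyNorm_aeval_le hH hK hC hp _)

end Minres

section Chebyshev

open Polynomial

theorem eval_chebyshev_T_half_add_inv {F : Type*} [Field F] [NeZero (2 : F)] {q : F}
    (hq : q ≠ 0) (m : ℕ) :
    (Chebyshev.T F m).eval ((q + q⁻¹) / 2) = (q ^ m + q⁻¹ ^ m) / 2 := by
  have h2 : (2 : F) ≠ 0 := two_ne_zero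
  induction m using Nat.twoStepInduction with
  | zero => simp [one_add_one_eq_two, h2]
  | one => simp
  | more m ih ih' =>
    push_cast at ih' ⊢
    rw [Chebyshev.T_add_two, eval_sub, eval_mul, ih, ih', eval_mul, eval_X, eval_ofNat]
    linear_combination (q + q⁻¹) * (q ^ (m + 1) + q⁻¹ ^ (m + 1)) / 2 * mul_inv_cancel₀ h2 +
      (q ^ m + q⁻¹ ^ m) / 2 * mul_inv_cancel₀ hq

theorem pow_le_two_mul_eval_chebyshev_T {a b : ℝ} (ha : 0 ≤ a) (hab : a < b) (m : ℕ) :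
    ((b + a) / (b - a)) ^ m ≤
      2 * (Chebyshev.T ℝ m).eval ((b ^ 2 + a ^ 2) / (b ^ 2 - a ^ 2)) := by
  have hsub : 0 < b - a := sub_pos.mpr hab
  have hadd : 0 < b + a := by linarith
  have harg : (b ^ 2 + a ^ 2) / (b ^ 2 - a ^ 2) =
      ((b + a) / (b - a) + ((b + a) / (b - a))⁻¹) / 2 := by
    rw [sq_sub_sq]
    field_simp
    ring
  rw [harg, eval_chebyshev_T_half_add_inv (by positivity), mul_div_cancel₀ _ two_ne_zero]
  exact le_add_of_nonneg_right (by positivity)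

theorem exists_polynomial_abs_eval_le {a b : ℝ} (ha : 0 < a) (hab : a ≤ b) (m : ℕ) :
    ∃ p : ℝ[X], p.eval 0 = 1 ∧ p.natDegree ≤ m ∧
      ∀ x ∈ Set.Icc (a ^ 2) (b ^ 2), |p.eval x| ≤ 2 * ((b - a) / (b + a)) ^ m := by
  rcases hab.eq_or_lt with rfl | hab
  · refine ⟨(1 - C (a ^ 2)⁻¹ * X) ^ m, by simp, by compute_degree, fun x hx => ?_⟩
    obtain rfl : x = a ^ 2 := le_antisymm hx.2 hx.1
    rcases m.eq_zero_or_pos with rfl | hm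
    · simp
    · simp [ha.ne', hm.ne']
  have hsub : 0 < b - a := sub_pos.mpr hab
  have hadd : 0 < b + a := by linarith
  have hw : 0 < b ^ 2 - a ^ 2 := by
    rw [sq_sub_sq]
    exact mul_pos hadd hsub
  let affine : ℝ[X] := C ((b ^ 2 + a ^ 2) / (b ^ 2 - a ^ 2)) - C (2 / (b ^ 2 - a ^ 2)) * X
  set M := (Chebyshev.T ℝ m).eval ((b ^ 2 + a ^ 2) / (b ^ 2 - a ^ 2)) with hM
  have hgrowth : ((b + a) / (b - a)) ^ m / 2 ≤ M := by
    rw [div_le_iff₀' two_pos]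
    exact pow_le_two_mul_eval_chebyshev_T ha.le hab m
  have hM₀ : 0 < M := lt_of_lt_of_le (by positivity) hgrowth
  refine ⟨C M⁻¹ * (Chebyshev.T ℝ m).comp affine, by simp [affine, ← hM, hM₀.ne'], ?_,
    fun x hx => ?_⟩
  · have haffine : affine.natDegree ≤ 1 := by
      unfold affine
      compute_degree
    calc (C M⁻¹ * (Chebyshev.T ℝ m).comp affine).natDegree
        ≤ (Chebyshev.T ℝ m).natDegree * affine.natDegree :=
          (natDegree_C_mul_le _ _).trans natDegree_comp_le
      _ ≤ m * 1 := Nat.mul_le_mul (by simp) haffine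
      _ = m := mul_one m
  · have hmem : |affine.eval x| ≤ 1 := by
      have heval : affine.eval x = (b ^ 2 + a ^ 2 - 2 * x) / (b ^ 2 - a ^ 2) := by
        simp only [affine, eval_sub, eval_mul, eval_C, eval_X]
        ring
      rw [heval, abs_div, abs_of_pos hw, div_le_one hw, abs_le]
      constructor <;> linarith [hx.1, hx.2]
    rw [eval_mul, eval_C, eval_comp, abs_mul, abs_of_pos (inv_pos.mpr hM₀)]
    calc M⁻¹ * |(Chebyshev.T ℝ m).eval (affine.eval x)| ≤ M⁻¹ * 1 := by
          gcongr
          exact Chebyshev.abs_eval_T_real_le_one m hmem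
      _ ≤ (((b + a) / (b - a)) ^ m / 2)⁻¹ := by
          rw [mul_one]
          gcongr
      _ = 2 * ((b - a) / (b + a)) ^ m := by rw [inv_div, div_eq_mul_inv, ← inv_pow, inv_div]

theorem exists_polynomial_abs_eval_le_of_sq_mem {a b : ℝ} (ha : 0 < a) (hab : a ≤ b) (m : ℕ) :
    ∃ p : ℝ[X], p.eval 0 = 1 ∧ p.natDegree ≤ 2 * m ∧
      ∀ x, x ^ 2 ∈ Set.Icc (a ^ 2) (b ^ 2) → |p.eval x| ≤ 2 * ((b - a) / (b + a)) ^ m := by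
  obtain ⟨p, hp₀, hpm, hp⟩ := exists_polynomial_abs_eval_le ha hab m
  refine ⟨p.comp (X ^ 2), by simpa using hp₀, ?_, fun x hx => by simpa using hp _ hx⟩
  rw [natDegree_comp, natDegree_X_pow]
  linarith

theorem rate_pow_two_mul {ε : ℝ} (hε : 0 ≤ ε) (m : ℕ) :
    rate ε ^ (2 * m) = (ε / (2 + ε)) ^ m := by
  rw [rate, pow_mul, Real.sq_sqrt (by positivity)]

theorem rate_mem_Ioo {ε : ℝ} (hε : 0 < ε) : rate ε ∈ Set.Ioo 0 1 := by
  refine ⟨Real.sqrt_pos.mpr (by positivity), ?_⟩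
  rw [rate, Real.sqrt_lt' one_pos, one_pow, div_lt_one (by positivity)]
  linarith

end Chebyshev

section ConvergenceRate

variable {ε t μ : ℝ}

theorem mem_union_Icc_of_sq_mem_Icc (hε : 0 ≤ ε) (hμ : μ ^ 2 ∈ Set.Icc 1 ((1 + ε) ^ 2)) :
    μ ∈ Set.Icc (-(1 + ε)) (-1) ∪ Set.Icc 1 (1 + ε) := by
  have hle := abs_le.mp (abs_le_of_sq_le_sq hμ.2 (by linarith))
  rcases le_abs.mp ((one_le_sq_iff_one_le_abs μ).mp hμ.1) with hge | hge
  · exact Or.inr ⟨hge, hle.2⟩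
  · exact Or.inl ⟨hle.1, le_neg.mp hge⟩

theorem exists_one_add_sq_eq (t : ℝ) : ∃ ε : ℝ, 0 ≤ ε ∧ (1 + ε) ^ 2 = 1 + t ^ 2 := by
  refine ⟨√(1 + t ^ 2) - 1, sub_nonneg.mpr ?_, ?_⟩
  · exact Real.one_le_sqrt.mpr (le_add_of_nonneg_right (sq_nonneg t))
  · rw [add_sub_cancel, Real.sq_sqrt (by positivity)]

theorem mem_Ioo_of_one_add_sq_eq (hε : 0 ≤ ε) (hεt : (1 + ε) ^ 2 = 1 + t ^ 2) (ht : 0 < t) :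
    ε ∈ Set.Ioo 0 t := by
  have hε₀ : 0 < ε := hε.lt_of_ne fun h => by
    rw [← h] at hεt
    linarith [pow_pos ht 2]
  refine ⟨hε₀, lt_of_pow_lt_pow_left₀ 2 ht.le ?_⟩
  linarith

theorem eq_zero_of_one_add_sq_eq (hε : 0 ≤ ε) (hε₁ : (1 + ε) ^ 2 = 1) : ε = 0 := by
  have h := (pow_eq_one_iff_of_nonneg (by linarith) two_ne_zero).mp hε₁
  linarith

theorem energyNorm_minres_le_rate {ι : Type*} [Fintype ι] [DecidableEq ι] {H K : Matrix ι ι ℝ}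
    (hH : H.PosDef) (hK : K.IsHermitian) (hε : 0 ≤ ε)
    (hspec : ∀ μ ∈ spectrum ℝ (H⁻¹ * K), μ ^ 2 ∈ Set.Icc 1 ((1 + ε) ^ 2))
    {c u₀ u : ι → ℝ} {k : ℕ} (hu : IsMinresIterate H K c u₀ k u) :
    energyNorm H (precondResidual H K c u) ≤
      2 * rate ε ^ (2 * (k / 2)) * energyNorm H (precondResidual H K c u₀) := by
  obtain ⟨p, hp₀, hpk, hp⟩ := exists_polynomial_abs_eval_le_of_sq_mem one_pos
    (le_add_of_nonneg_right hε) (k / 2)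
  rw [rate_pow_two_mul hε]
  refine energyNorm_minres_le hH hK hu hp₀ (hpk.trans (Nat.mul_div_le k 2)) (by positivity)
    fun μ hμ => ?_
  have h := hp μ (by simpa only [one_pow] using hspec μ hμ)
  rwa [add_sub_cancel_left, add_right_comm, one_add_one_eq_two] at h

end ConvergenceRate

end FirstOrderScheme

open FirstOrderScheme Matrix in
theorem mainTheorem12_general (d : ℕ) (α dp dm : Fin d → ℝ) (hα : ∀ i, 1 < α i ∧ α i < 3)
    (hsum : ∀ i, 0 < dp i + dm i) :
    ∃ ε : ℝ,
      (0 < asymmetryBound α dp dm →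
        0 < ε ∧ ε < asymmetryBound α dp dm ∧ 0 < rate ε ∧ rate ε < 1) ∧
      (asymmetryBound α dp dm = 0 → ε = 0) ∧
      ∀ (τ : ℝ) (a b : Fin d → ℝ) (n : Fin d → ℕ),
        0 < τ → (∀ i, a i < b i) →
        ∀ A Y H : Matrix (Grid n) (Grid n) ℝ,
          A = schemeMatrix α dp dm τ a b n → Y = multiAntiIdentity n → H = symmPart A →
          H.PosDef ∧ (Y * A).IsSymm ∧
          (∀ z ∈ spectrum ℂ ((H⁻¹ * (Y * A)).map (algebraMap ℝ ℂ)),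
            ∃ t : ℝ, z = (t : ℂ) ∧ t ∈ Set.Icc (-(1 + ε)) (-1) ∪ Set.Icc 1 (1 + ε)) ∧
          ∀ (f u₀ : Grid n → ℝ) (k : ℕ) (u : Grid n → ℝ),
            IsMinresIterate H (Y * A) (Y *ᵥ f) u₀ k u →
            energyNorm H (precondResidual H (Y * A) (Y *ᵥ f) u) ≤
              2 * rate ε ^ (2 * (k / 2)) *
                energyNorm H (precondResidual H (Y * A) (Y *ᵥ f) u₀) := by
  obtain ⟨ε, hε, hεt⟩ := exists_one_add_sq_eq (asymmetryBound α dp dm)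
  refine ⟨ε, fun ht => ?_, fun ht => ?_, ?_⟩
  · have hεt := mem_Ioo_of_one_add_sq_eq hε hεt ht
    exact ⟨hεt.1, hεt.2, rate_mem_Ioo hεt.1⟩
  · exact eq_zero_of_one_add_sq_eq hε (by simpa [ht] using hεt)
  · rintro τ a b n hτ hab A Y H rfl rfl rfl
    have hH := posDef_symmPart fun x hx => schemeMatrix_form_pos (n := n) hα hsum hτ hab hx
    have hsymm := isSymm_multiAntiIdentity_mul_schemeMatrix (n := n) α dp dm τ a b
    have hK := isHermitian_iff_isSymm.mpr hsymm
    have hspec := fun μ hμ => hεt ▸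
      (hasSectorialForm_schemeMatrix hα hsum hτ hab).sq_mem_Icc_of_mem_spectrum (μ := μ) hH
        multiAntiIdentity_mul_self
        (multiAntiIdentity_mul_schemeMatrix_mul_multiAntiIdentity α dp dm τ a b) hμ
    refine ⟨hH, hsymm, fun z hz => ?_, fun f u₀ k u => energyNorm_minres_le_rate hH hK hε hspec⟩
    rw [spectrum_map_inv_mul hH hK] at hz
    obtain ⟨μ, hμ, rfl⟩ := hz
    exact ⟨μ, rfl, mem_union_Icc_of_sq_mem_Icc hε (hspec μ hμ)⟩

theorem mainTheorem12 (d : ℕ) (hd : 0 < d) (α dp dm : Fin d → ℝ)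
    (hα : ∀ i, 1 < α i ∧ α i < 2) (hdp : ∀ i, 0 ≤ dp i) (hdm : ∀ i, 0 ≤ dm i)
    (hsum : ∀ i, 0 < dp i + dm i) :
    ∃ ε : ℝ,
      (0 < FirstOrderScheme.asymmetryBound α dp dm →
        0 < ε ∧ ε < FirstOrderScheme.asymmetryBound α dp dm ∧
          0 < FirstOrderScheme.rate ε ∧ FirstOrderScheme.rate ε < 1) ∧
      (FirstOrderScheme.asymmetryBound α dp dm = 0 → ε = 0) ∧
      ∀ (τ : ℝ) (a b : Fin d → ℝ) (n : Fin d → ℕ),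
        0 < τ → (∀ i, a i < b i) → (∀ i, 0 < n i) →
        ∀ (A Y H : Matrix (FirstOrderScheme.Grid n) (FirstOrderScheme.Grid n) ℝ),
          A = FirstOrderScheme.schemeMatrix α dp dm τ a b n →
          Y = FirstOrderScheme.multiAntiIdentity n →
          H = FirstOrderScheme.symmPart A →
          H.PosDef ∧ (Y * A).IsSymm ∧
          (∀ z ∈ spectrum ℂ ((H⁻¹ * (Y * A)).map (algebraMap ℝ ℂ)),
            ∃ t : ℝ, z = (t : ℂ) ∧ t ∈ Set.Icc (-(1 + ε)) (-1) ∪ Set.Icc 1 (1 + ε)) ∧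
          ∀ (f u₀ : FirstOrderScheme.Grid n → ℝ) (k : ℕ) (u : FirstOrderScheme.Grid n → ℝ),
            FirstOrderScheme.IsMinresIterate H (Y * A) (Y.mulVec f) u₀ k u →
            FirstOrderScheme.energyNorm H
                (FirstOrderScheme.precondResidual H (Y * A) (Y.mulVec f) u) ≤
              2 * FirstOrderScheme.rate ε ^ (2 * (k / 2)) *
                FirstOrderScheme.energyNorm H
                  (FirstOrderScheme.precondResidual H (Y * A) (Y.mulVec f) u₀) := by
  obtain ⟨ε, hpos, hzero, h⟩ := mainTheorem12_general d α dp dm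
    (fun i => ⟨(hα i).1, (hα i).2.trans (by norm_num)⟩) hsum
  exact ⟨ε, hpos, hzero, fun τ a b n hτ hab _ => h τ a b n hτ hab⟩
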